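/- For $z\in\mathbb{C}$, $|z|\le 1/\sqrt8$, let $f(t)=\dfrac{1-\sqrt{1-4z^2(1+t^2)}}{2z(1+t^2)}\,t$ and define $\alpha_k=\alpha_k(z)$, $\beta_k=\beta_k(z)$ by $\alpha_0=\dfrac{1-\sqrt{1-8z^2}}{4z}$, $\beta_k=f(\alpha_k)$, $\alpha_{k+1}=f(\beta_k)$ for $k\ge 0$ (principal square roots; all these functions take the value $0$ at $z=0$). Let $x_{i,j}=\sum_{k\ge0}(1-\beta_k)\beta_k^{\,j}\big[(1-\alpha_k)\alpha_k^{\,i}-(1-\alpha_{k+1})\alpha_{k+1}^{\,i}\big]$, $\widehat{x}_{i,j}=x_{i,j}+x_{j,i}$, so that $\widehat{x}_{0,0}=2\sum_{k\ge0}(1-\beta_k)(\alpha_{k+1}-\alpha_k)$, and let $h(z)=1-2z+z\,\widehat{x}_{0,0}(z)$ and $c(z)=1/h(z)$. Then: (1) For every $|z|\le 1/\sqrt8$ the series defining $\widehat{x}_{0,0}(z)$ converges, and $h$ is the sum of a power series $\sum_n a_nz^n$ that converges to $h(z)$ for every $|z|\le1/\sqrt8$ (in particular its radius of convergence is at least $1/\sqrt8$).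 (2) $h$ has a unique zero $\rho$ in the real interval $(1/3,1/\sqrt8)$; it is the first positive zero of $h$. (3) $\rho$ is the dominant singularity of $c$: $c$ is analytic in $|z|<\rho$, cannot be continued analytically from this disc at $\rho$, and can be continued analytically at every other point of the circle $|z|=\rho$. (4) $\rho\in[0.34499975,\,0.34499976]$. -/

import Mathlib

open Filter Topology

namespace QuarterWalk

noncomputable section

/-- `f(t) = (1 - √(1 - 4 z² (1 + t²))) / (2 z (1 + t²)) · t`, with the principal square root.
At `z = 0` the division convention gives `f(t) = 0`, which is the removable value. -/
def f (z t : ℂ) : ℂ :=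
  (1 - Complex.sqrt (1 - 4 * z ^ 2 * (1 + t ^ 2))) / (2 * z * (1 + t ^ 2)) * t

/-- `α₀ = (1 - √(1 - 8 z²)) / (4 z)` and `α_{k+1} = f(β_k)`, where `β_k = f(α_k)`.
At `z = 0` the division convention gives `α₀ = 0`, which is the removable value. -/
def α : ℕ → ℂ → ℂ
  | 0, z => (1 - Complex.sqrt (1 - 8 * z ^ 2)) / (4 * z)
  | k + 1, z => f z (f z (α k z))

/-- `β_k = f(α_k)`. -/
def β (k : ℕ) (z : ℂ) : ℂ := f z (α k z)

/-- The `k`-th term of the series `x_{i,j}(z)`. -/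
def xTerm (i j k : ℕ) (z : ℂ) : ℂ :=
  (1 - β k z) * β k z ^ j *
    ((1 - α k z) * α k z ^ i - (1 - α (k + 1) z) * α (k + 1) z ^ i)

/-- `x_{i,j}(z) = ∑_k (1 - β_k) β_k^j [(1 - α_k) α_k^i - (1 - α_{k+1}) α_{k+1}^i]`. -/
def x (i j : ℕ) (z : ℂ) : ℂ := ∑' k, xTerm i j k z

/-- `x̂_{i,j} = x_{i,j} + x_{j,i}`. -/
def xHat (i j : ℕ) (z : ℂ) : ℂ := x i j z + x j i z

/-- `h(z) = 1 - 2 z + z x̂_{0,0}(z)`. -/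
def h (z : ℂ) : ℂ := 1 - 2 * z + z * xHat 0 0 z

/-- `c(z) = 1 / (1 - 2 z + z x̂_{0,0}(z))`. -/
def c (z : ℂ) : ℂ := 1 / (1 - 2 * z + z * xHat 0 0 z)

/-- `F`, considered on the region `Ω`, can be continued analytically at the point `w`: some
function analytic in a neighbourhood `U` of `w` agrees with `F` on `U ∩ Ω`. -/
def ContinuableAt (F : ℂ → ℂ) (Ω : Set ℂ) (w : ℂ) : Prop :=
  ∃ g : ℂ → ℂ, AnalyticAt ℂ g w ∧ ∀ᶠ z in 𝓝[Ω] w, g z = F z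

/-- `ζ` is the dominant singularity of `F`, that is, its unique singularity closest to the
origin: `F` is analytic in the open disc `|z| < |ζ|`, cannot be continued analytically from this
disc at `ζ`, and can be continued analytically at every other point of the circle `|z| = |ζ|`. -/
structure IsDominantSingularity (F : ℂ → ℂ) (ζ : ℂ) : Prop where
  analytic : ∀ z ∈ Metric.ball (0 : ℂ) ‖ζ‖, AnalyticAt ℂ F z
  singular : ¬ ContinuableAt F (Metric.ball 0 ‖ζ‖) ζ
  unique : ∀ w ∈ Metric.sphere (0 : ℂ) ‖ζ‖, w ≠ ζ → ContinuableAt F (Metric.ball 0 ‖ζ‖) w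

end

end QuarterWalk

namespace QuarterWalk

noncomputable section

/-! The sequence `1, α₀, β₀, α₁, β₁, …` is the orbit `Y_n` (`chain`) of `1` under `f z`. It decays
at least like `(2r)^n`, where `r = 1/√8` and `2r = 1/√2`, and consecutive terms `s, t` lie on the
curve `s t = z (s² + t² + s² t²)`. This is the kernel of quarter plane walks with steps NE, SE, NW.
If `A(z, s)` (`axisGF`) counts those ending on the horizontal axis, then `s t = z s² A(z, s) + z t²
A(z, t)` on the curve (`axisGF_kernel`). Iterating from `s = 1` gives `z A(z, 1) = ∑ (-1)^n Y_n
Y_{n+1}`, which regroups to `-x_{0,0}` (`x_eq_axisGF`). Hence `h = 1 - 2z - 2z² A(z, 1)`, where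
`A(z, 1)` has nonnegative coefficients.

Positivity does the rest. The bound `u A(u, 1) ≤ 1` for `0 ≤ u < r` makes the series of `A` summable
at `r`. On `[0, r]` the function `h` is strictly decreasing, and a positive zero is the only zero in
its closed disc (`eq_of_h_eq_zero`), hence the dominant singularity of `1/h`. It is located by a
sign change: truncating the alternating sum errs in a known direction (`axisGF_enclosure`), and the
real orbit is enclosed by rational arithmetic (`realChain_succ_mem`). -/

/-! ### The principal square root and the map `f`. -/

theorem radius_pos : (0 : ℝ) < 1 / √8 := by positivity

theorem radius_sq : (1 / √8 : ℝ) ^ 2 = 1 / 8 := by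
  rw [div_pow, Real.sq_sqrt (by norm_num)]; norm_num

theorem radius_mul_inv : (1 / √8 : ℝ) * √8 = 1 := by
  rw [one_div, inv_mul_cancel₀]; positivity

theorem radius_lt : (1 / √8 : ℝ) < 2 / 5 := by
  nlinarith [radius_sq, radius_pos]

theorem sqrt_sq (w : ℂ) : w.sqrt ^ 2 = w := by
  have := Complex.cpow_nat_inv_pow w (n := 2) two_ne_zero
  simpa only [Complex.sqrt, Nat.cast_ofNat] using this

theorem sqrt_re_nonneg (w : ℂ) : 0 ≤ w.sqrt.re := by
  rw [Complex.sqrt, Complex.cpow_inv_two_re]; positivity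

theorem one_le_norm_one_add_sqrt (w : ℂ) : 1 ≤ ‖1 + w.sqrt‖ := by
  refine le_trans ?_ (Complex.re_le_norm _)
  have := sqrt_re_nonneg w
  simp; linarith

theorem one_add_sqrt_ne_zero (w : ℂ) : 1 + w.sqrt ≠ 0 := by
  intro h0
  have := one_le_norm_one_add_sqrt w
  rw [h0, norm_zero] at this
  linarith

/-- Rationalising removes the singularity at `z = 0`; the new denominator has modulus at least `1`
because the principal root has nonnegative real part. -/
theorem f_eq (z : ℂ) {t : ℂ} (ht : 1 + t ^ 2 ≠ 0) :
    f z t = 2 * z / (1 + (1 - 4 * z ^ 2 * (1 + t ^ 2)).sqrt) * t := by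
  rcases eq_or_ne z 0 with rfl | hz
  · simp [f]
  have hd := sqrt_sq (1 - 4 * z ^ 2 * (1 + t ^ 2))
  have h1 := one_add_sqrt_ne_zero (1 - 4 * z ^ 2 * (1 + t ^ 2))
  unfold f
  generalize (1 - 4 * z ^ 2 * (1 + t ^ 2)).sqrt = d at *
  congr 1
  rw [div_eq_div_iff (by simp [hz, ht]) h1]
  linear_combination -hd

/-- `f z t` is a root `y` of `z (1 + t²) y² - t y + z t² = 0`, namely the branch vanishing at `z =
0`. -/
theorem f_kernel (z : ℂ) {t : ℂ} (ht : 1 + t ^ 2 ≠ 0) :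
    t * f z t = z * (t ^ 2 + f z t ^ 2 + t ^ 2 * f z t ^ 2) := by
  have hd := sqrt_sq (1 - 4 * z ^ 2 * (1 + t ^ 2))
  have h1 := one_add_sqrt_ne_zero (1 - 4 * z ^ 2 * (1 + t ^ 2))
  rw [f_eq z ht]
  generalize (1 - 4 * z ^ 2 * (1 + t ^ 2)).sqrt = d at *
  field_simp
  linear_combination -z * t ^ 2 * hd

theorem norm_f_le (z : ℂ) {t : ℂ} (ht : 1 + t ^ 2 ≠ 0) : ‖f z t‖ ≤ 2 * ‖z‖ * ‖t‖ := by
  rw [f_eq z ht, norm_mul, norm_div, norm_mul, Complex.norm_ofNat]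
  gcongr
  exact div_le_self (by positivity) (one_le_norm_one_add_sqrt _)

/-! ### The orbit of `1`: decay, kernel relation, continuity. -/

/-- The orbit of `1` under `f z`, which interlaces the sequences `α` and `β`. -/
def chain (z : ℂ) : ℕ → ℂ
  | 0 => 1
  | n + 1 => f z (chain z n)

theorem α_eq_chain (z : ℂ) (k : ℕ) : α k z = chain z (2 * k + 1) := by
  induction k with
  | zero => simp only [α, chain, f]; norm_num; ring_nf
  | succ k ih => rw [α, ih]; rfl

theorem β_eq_chain (z : ℂ) (k : ℕ) : β k z = chain z (2 * k + 2) := by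
  rw [β, α_eq_chain]; rfl

theorem one_add_sq_ne_zero {t : ℂ} (ht : ‖t‖ < 1) : 1 + t ^ 2 ≠ 0 := by
  intro h0
  have h1 : t ^ 2 = -1 := by linear_combination h0
  have h2 : ‖t‖ ^ 2 = 1 := by rw [← norm_pow, h1]; simp
  nlinarith [norm_nonneg t]

/-- Proved jointly: the bound on `f` needs `1 + t² ≠ 0`, and for later terms this follows from the
bound. At the start `t = 1` it holds by inspection. -/
theorem chain_bounds {z : ℂ} (hz : ‖z‖ ≤ 1 / √8) (n : ℕ) :
    1 + chain z n ^ 2 ≠ 0 ∧ ‖chain z n‖ ≤ (2 * (1 / √8)) ^ n := by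
  induction n with
  | zero => constructor <;> norm_num [chain]
  | succ n ih =>
    have hr := radius_lt
    have hr0 := radius_pos
    have hb : ‖chain z (n + 1)‖ ≤ (2 * (1 / √8)) ^ (n + 1) := by
      rw [pow_succ']
      refine (norm_f_le z ih.1).trans ?_
      gcongr
      exact ih.2
    exact ⟨one_add_sq_ne_zero (hb.trans_lt (pow_lt_one₀ (by positivity) (by linarith)
      (by simp))), hb⟩

theorem norm_chain_le_one {z : ℂ} (hz : ‖z‖ ≤ 1 / √8) (n : ℕ) : ‖chain z n‖ ≤ 1 :=
  (chain_bounds hz n).2.trans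
    (pow_le_one₀ (by positivity) (by linarith [radius_lt]))

theorem norm_chain_succ_le {z : ℂ} (hz : ‖z‖ ≤ 1 / √8) (n : ℕ) :
    ‖chain z (n + 1)‖ ≤ 2 * (1 / √8) := by
  refine (norm_f_le z (chain_bounds hz n).1).trans ?_
  calc 2 * ‖z‖ * ‖chain z n‖ ≤ 2 * ‖z‖ * 1 := by gcongr; exact norm_chain_le_one hz n
    _ ≤ _ := by linarith

theorem chain_kernel {z : ℂ} (hz : ‖z‖ ≤ 1 / √8) (n : ℕ) :
    chain z n * chain z (n + 1) = z * (chain z n ^ 2 + chain z (n + 1) ^ 2 +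
      chain z n ^ 2 * chain z (n + 1) ^ 2) :=
  f_kernel z (chain_bounds hz n).1

theorem radicand_re_nonneg {z t : ℂ} (hz : ‖z‖ ≤ 1 / √8) (ht : ‖t‖ ≤ 1) :
    0 ≤ (1 - 4 * z ^ 2 * (1 + t ^ 2)).re := by
  have h1 : ‖4 * z ^ 2 * (1 + t ^ 2)‖ ≤ 1 := by
    rw [norm_mul, norm_mul, norm_pow, Complex.norm_ofNat]
    have h2 : ‖z‖ ^ 2 ≤ 1 / 8 := by
      rw [← radius_sq]; gcongr
    have h3 : ‖1 + t ^ 2‖ ≤ 2 := by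
      refine (norm_add_le _ _).trans ?_
      rw [norm_one, norm_pow]
      nlinarith [norm_nonneg t]
    calc 4 * ‖z‖ ^ 2 * ‖1 + t ^ 2‖ ≤ 4 * (1 / 8) * 2 := by gcongr
      _ = 1 := by norm_num
  have := Complex.re_le_norm (4 * z ^ 2 * (1 + t ^ 2))
  rw [Complex.sub_re, Complex.one_re]
  linarith

/-- The radicands have nonnegative real part, so they avoid the cut; they may vanish (for `n = 0` at
`z = ±1/√8`), where the root is still continuous. -/
theorem continuousOn_chain (n : ℕ) :
    ContinuousOn (fun z => chain z n) (Metric.closedBall 0 (1 / √8)) := by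
  induction n with
  | zero => exact continuousOn_const
  | succ n ih =>
    have hmem {z : ℂ} (hz : z ∈ Metric.closedBall (0 : ℂ) (1 / √8)) : ‖z‖ ≤ 1 / √8 := by
      simpa using hz
    have hrad : ContinuousOn (fun z : ℂ => 1 - 4 * z ^ 2 * (1 + chain z n ^ 2))
        (Metric.closedBall 0 (1 / √8)) := by fun_prop
    have hsqrt : ContinuousOn (fun z : ℂ => (1 - 4 * z ^ 2 * (1 + chain z n ^ 2)).sqrt)
        (Metric.closedBall 0 (1 / √8)) := fun z hz =>
      ContinuousAt.comp_continuousWithinAt (g := Complex.sqrt)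
        (Complex.continuousAt_sqrt (Or.inl (radicand_re_nonneg (hmem hz)
          (norm_chain_le_one (hmem hz) n)))) (hrad z hz)
    have hstep : ∀ z ∈ Metric.closedBall (0 : ℂ) (1 / √8), chain z (n + 1) =
        2 * z / (1 + (1 - 4 * z ^ 2 * (1 + chain z n ^ 2)).sqrt) * chain z n :=
      fun z hz => by rw [chain, f_eq z (chain_bounds (hmem hz) n).1]
    have hnum : ContinuousOn (fun z : ℂ => 2 * z) (Metric.closedBall 0 (1 / √8)) := by fun_prop
    have hden : ContinuousOn (fun z : ℂ => 1 + (1 - 4 * z ^ 2 * (1 + chain z n ^ 2)).sqrt)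
        (Metric.closedBall 0 (1 / √8)) := continuousOn_const.add hsqrt
    exact ((hnum.div hden fun z _ => one_add_sqrt_ne_zero _).mul ih).congr hstep

/-- The orbit of `1` for a real parameter. -/
def realChain (u : ℝ) : ℕ → ℝ
  | 0 => 1
  | n + 1 => 2 * u / (1 + √(1 - 4 * u ^ 2 * (1 + realChain u n ^ 2))) * realChain u n

theorem realChain_nonneg {u : ℝ} (hu : 0 ≤ u) (n : ℕ) : 0 ≤ realChain u n := by
  induction n with
  | zero => simp [realChain]
  | succ n ih => rw [realChain]; positivity

theorem chain_ofReal {u : ℝ} (hu : 0 ≤ u) (hu' : u ≤ 1 / √8) (n : ℕ) :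
    chain u n = realChain u n := by
  have hz : ‖(u : ℂ)‖ ≤ 1 / √8 := by simpa [abs_of_nonneg hu] using hu'
  induction n with
  | zero => simp [chain, realChain]
  | succ n ih =>
    have h0 := radicand_re_nonneg hz (norm_chain_le_one hz n)
    have hb := (chain_bounds hz n).1
    rw [chain, f_eq _ hb, ih]
    rw [ih] at h0
    have hcast : (1 - 4 * (u : ℂ) ^ 2 * (1 + (realChain u n : ℂ) ^ 2)) =
        ((1 - 4 * u ^ 2 * (1 + realChain u n ^ 2) : ℝ) : ℂ) := by push_cast; ring
    rw [hcast, Complex.ofReal_re] at h0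
    rw [hcast, Complex.sqrt_of_nonneg (by exact_mod_cast h0), Complex.ofReal_re, realChain]
    push_cast
    ring

/-! ### Quarter plane walks and the kernel equation. -/

/-- One step of a quarter plane walk with steps NE, SE and NW, acting on functions of the
position. -/
def step : Module.End ℂ (ℕ → ℕ → ℂ) where
  toFun φ i j := φ (i + 1) (j + 1) + (if j = 0 then 0 else φ (i + 1) (j - 1)) +
    (if i = 0 then 0 else φ (i - 1) (j + 1))
  map_add' φ ψ := by
    ext i j
    by_cases hi : i = 0 <;> by_cases hj : j = 0 <;> simp [hi, hj] <;> ring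
  map_smul' c φ := by
    ext i j
    by_cases hi : i = 0 <;> by_cases hj : j = 0 <;> simp [hi, hj] <;> ring

theorem step_apply (φ : ℕ → ℕ → ℂ) (i j : ℕ) :
    step φ i j = φ (i + 1) (j + 1) + (if j = 0 then 0 else φ (i + 1) (j - 1)) +
      (if i = 0 then 0 else φ (i - 1) (j + 1)) := rfl

/-- The total weight of the `n`-step walks from the origin, weighted by `φ` at the endpoint. -/
def walkSum (n : ℕ) : (ℕ → ℕ → ℂ) →ₗ[ℂ] ℂ :=
  LinearMap.proj 0 ∘ₗ LinearMap.proj 0 ∘ₗ step ^ n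

theorem walkSum_apply (n : ℕ) (φ : ℕ → ℕ → ℂ) : walkSum n φ = (step ^ n) φ 0 0 := rfl

theorem walkSum_zero (φ : ℕ → ℕ → ℂ) : walkSum 0 φ = φ 0 0 := rfl

theorem walkSum_succ (n : ℕ) (φ : ℕ → ℕ → ℂ) : walkSum (n + 1) φ = walkSum n (step φ) := by
  simp [walkSum_apply, pow_succ]

/-- The step set is symmetric in the diagonal, so a single axis function serves both boundary terms
of the kernel equation. -/
theorem walkSum_swap (n : ℕ) (φ : ℕ → ℕ → ℂ) :
    walkSum n (fun i j => φ j i) = walkSum n φ := by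
  induction n generalizing φ with
  | zero => rfl
  | succ n ih =>
    rw [walkSum_succ, walkSum_succ, ← ih]
    congr 1
    ext i j
    simp only [step_apply]
    ring

/-- Away from the axes the weight `(1/√2)^j` is an eigenfunction of `step` with eigenvalue `1/√2 +
√2 + 1/√2 = √8`, and killing walks at the axes only helps. The constant weight would give only
growth `3`. -/
theorem norm_walkSum_le (n : ℕ) {φ : ℕ → ℕ → ℂ} {C : ℝ}
    (hφ : ∀ i j, ‖φ i j‖ ≤ C * (2 * (1 / √8)) ^ j) : ‖walkSum n φ‖ ≤ C * √8 ^ n := by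
  induction n generalizing φ C with
  | zero => simpa [walkSum_zero] using hφ 0 0
  | succ n ih =>
    rw [walkSum_succ, pow_succ', ← mul_assoc]
    refine ih fun i j => ?_
    have hr := radius_pos
    have hr2 := radius_sq
    have hmul := radius_mul_inv
    generalize 1 / √8 = r at *
    have hC : 0 ≤ C := by simpa using (norm_nonneg _).trans (hφ 0 0)
    have hinv : √8 = 8 * r := by
      have : r * (√8 - 8 * r) = 0 := by linear_combination hmul - 8 * hr2
      rcases mul_eq_zero.mp this with h0 | h0 <;> linarith
    have hpow : 0 ≤ C * (2 * r) ^ j := by positivity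
    have h1 : ‖if i = 0 then 0 else φ (i - 1) (j + 1)‖ ≤ C * (2 * r) ^ (j + 1) := by
      split_ifs
      · rw [norm_zero]; positivity
      · exact hφ _ _
    have h2 : ‖if j = 0 then 0 else φ (i + 1) (j - 1)‖ ≤ C * (4 * r * (2 * r) ^ j) := by
      split_ifs with hj
      · rw [norm_zero]; positivity
      · obtain ⟨k, rfl⟩ := Nat.exists_eq_succ_of_ne_zero hj
        refine (hφ _ _).trans (le_of_eq ?_)
        simp only [Nat.succ_eq_add_one, Nat.add_sub_cancel, pow_succ]
        linear_combination -8 * C * (2 * r) ^ k * hr2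
    have h3 := hφ (i + 1) (j + 1)
    rw [step_apply]
    refine (norm_add₃_le).trans ?_
    rw [hinv]
    calc _ ≤ C * (2 * r) ^ (j + 1) + C * (4 * r * (2 * r) ^ j) + C * (2 * r) ^ (j + 1) := by
          gcongr
      _ = _ := by ring

theorem walkSum_nonneg (n : ℕ) {φ : ℕ → ℕ → ℂ} (hφ : ∀ i j, ∃ r : ℝ, 0 ≤ r ∧ φ i j = r) :
    ∃ r : ℝ, 0 ≤ r ∧ walkSum n φ = r := by
  induction n generalizing φ with
  | zero => exact hφ 0 0
  | succ n ih =>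
    rw [walkSum_succ]
    refine ih fun i j => ?_
    have hite (p : Prop) [Decidable p] (i j : ℕ) :
        ∃ r : ℝ, 0 ≤ r ∧ (if p then 0 else φ i j) = r := by
      split_ifs
      · exact ⟨0, le_rfl, by simp⟩
      · exact hφ i j
    obtain ⟨r₁, h₁, e₁⟩ := hφ (i + 1) (j + 1)
    obtain ⟨r₂, h₂, e₂⟩ := hite (j = 0) (i + 1) (j - 1)
    obtain ⟨r₃, h₃, e₃⟩ := hite (i = 0) (i - 1) (j + 1)
    exact ⟨r₁ + r₂ + r₃, by positivity, by rw [step_apply, e₁, e₂, e₃]; push_cast; rfl⟩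

/-- The walks of length `n` ending on the horizontal axis, counted with weight `s ^ i` at
`(i, 0)`. -/
def axisSum (n : ℕ) (s : ℂ) : ℂ := walkSum n fun i j => if j = 0 then s ^ i else 0

/-- The generating function of the quarter plane walks ending on the horizontal axis. -/
def axisGF (z s : ℂ) : ℂ := ∑' n, axisSum n s * z ^ n

theorem norm_axisSum_le (n : ℕ) {s : ℂ} (hs : ‖s‖ ≤ 1) : ‖axisSum n s‖ ≤ √8 ^ n := by
  have := norm_walkSum_le n (φ := fun i j => if j = 0 then s ^ i else 0) (C := 1) fun i j => by
    split_ifs with hj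
    · simpa [hj] using pow_le_one₀ (norm_nonneg s) hs
    · rw [norm_zero]; positivity
  simpa [axisSum] using this

theorem mul_sqrt_eight_lt_one {z : ℂ} (hz : ‖z‖ < 1 / √8) : √8 * ‖z‖ < 1 := by
  rwa [lt_div_iff₀ (by positivity), mul_comm] at hz

theorem norm_axisTerm_le (z : ℂ) {s : ℂ} (hs : ‖s‖ ≤ 1) (n : ℕ) :
    ‖axisSum n s * z ^ n‖ ≤ (√8 * ‖z‖) ^ n := by
  rw [norm_mul, norm_pow, mul_pow]
  gcongr
  exact norm_axisSum_le n hs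

theorem summable_axisTerm {z s : ℂ} (hz : ‖z‖ < 1 / √8) (hs : ‖s‖ ≤ 1) :
    Summable fun n => axisSum n s * z ^ n :=
  Summable.of_norm_bounded (summable_geometric_of_lt_one (by positivity)
    (mul_sqrt_eight_lt_one hz)) (norm_axisTerm_le z hs)

theorem norm_axisGF_le {z s : ℂ} (hz : ‖z‖ < 1 / √8) (hs : ‖s‖ ≤ 1) :
    ‖axisGF z s‖ ≤ (1 - √8 * ‖z‖)⁻¹ :=
  tsum_of_norm_bounded (hasSum_geometric_of_lt_one (by positivity) (mul_sqrt_eight_lt_one hz))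
    (norm_axisTerm_le z hs)

theorem axisSum_ofReal_nonneg (n : ℕ) {s : ℝ} (hs : 0 ≤ s) :
    ∃ r : ℝ, 0 ≤ r ∧ axisSum n s = r :=
  walkSum_nonneg n fun i j => by
    split_ifs
    · exact ⟨s ^ i, by positivity, by push_cast; rfl⟩
    · exact ⟨0, le_rfl, by simp⟩

theorem axisGF_ofReal_nonneg {u s : ℝ} (hu : 0 ≤ u) (hs : 0 ≤ s) :
    ∃ r : ℝ, 0 ≤ r ∧ axisGF u s = r := by
  choose a ha ha' using fun n => axisSum_ofReal_nonneg n hs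
  refine ⟨∑' n, a n * u ^ n, tsum_nonneg fun n => mul_nonneg (ha n) (by positivity), ?_⟩
  rw [Complex.ofReal_tsum, axisGF]
  exact tsum_congr fun n => by rw [ha' n]; push_cast; rfl

/-- The subtracted terms are the steps that would leave the quadrant: SE from `j = 0` and NW from `i
= 0`. -/
theorem step_monomial (s t : ℂ) :
    (s * t) • step (fun i j => s ^ i * t ^ j) =
      (s ^ 2 + t ^ 2 + s ^ 2 * t ^ 2) • (fun i j : ℕ => s ^ i * t ^ j) -
        s ^ 2 • (fun i j : ℕ => if j = 0 then s ^ i else 0) -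
        t ^ 2 • (fun i j : ℕ => if i = 0 then t ^ j else 0) := by
  ext i j
  simp only [Pi.smul_apply, Pi.sub_apply, smul_eq_mul, step_apply]
  rcases i with _ | i <;> rcases j with _ | j <;> simp <;> ring

theorem walkSum_monomial_succ {z s t : ℂ} (hk : s * t = z * (s ^ 2 + t ^ 2 + s ^ 2 * t ^ 2))
    (n : ℕ) :
    s * t * walkSum n (fun i j => s ^ i * t ^ j) -
      s * t * (z * walkSum (n + 1) (fun i j => s ^ i * t ^ j)) =
      z * s ^ 2 * axisSum n s + z * t ^ 2 * axisSum n t := by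
  have h1 := congrArg (walkSum n) (step_monomial s t)
  simp only [map_sub, map_smul, smul_eq_mul, ← walkSum_succ] at h1
  rw [walkSum_swap n (fun i j => if j = 0 then t ^ i else 0)] at h1
  change _ = _ - s ^ 2 * axisSum n s - t ^ 2 * axisSum n t at h1
  linear_combination -z * h1 + walkSum n (fun i j => s ^ i * t ^ j) * hk

theorem axisGF_kernel {z s t : ℂ} (hz : ‖z‖ < 1 / √8) (hs : ‖s‖ ≤ 1) (ht : ‖t‖ ≤ 2 * (1 / √8))
    (hk : s * t = z * (s ^ 2 + t ^ 2 + s ^ 2 * t ^ 2)) :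
    s * t = z * s ^ 2 * axisGF z s + z * t ^ 2 * axisGF z t := by
  have ht1 : ‖t‖ ≤ 1 := ht.trans (by linarith [radius_lt])
  have hsum := (((summable_axisTerm hz hs).hasSum.mul_left (z * s ^ 2)).add
    ((summable_axisTerm hz ht1).hasSum.mul_left (z * t ^ 2))).tendsto_sum_nat
  -- On the kernel curve the sum over the length telescopes to `u 0 - u N`. The hypothesis `‖t‖ ≤ 2
  -- * (1 / √8)` makes `s^i t^j` an admissible weight for `norm_walkSum_le`, so `u N → 0`.
  set u : ℕ → ℂ := fun n => s * t * (z ^ n * walkSum n (fun i j => s ^ i * t ^ j)) with hu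
  have hterm (n : ℕ) : z * s ^ 2 * (axisSum n s * z ^ n) + z * t ^ 2 * (axisSum n t * z ^ n) =
      u n - u (n + 1) := by
    simp only [hu, pow_succ]
    linear_combination -z ^ n * walkSum_monomial_succ hk n
  simp only [hterm, Finset.sum_range_sub'] at hsum
  have hbound (n : ℕ) : ‖z ^ n * walkSum n (fun i j => s ^ i * t ^ j)‖ ≤ (√8 * ‖z‖) ^ n := by
    rw [norm_mul, norm_pow, mul_pow, mul_comm]
    gcongr
    have := norm_walkSum_le n (φ := fun i j => s ^ i * t ^ j) (C := 1) fun i j => by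
      rw [norm_mul, norm_pow, norm_pow]
      gcongr
      exact pow_le_one₀ (norm_nonneg s) hs
    simpa using this
  have hlim : Tendsto u atTop (𝓝 (s * t * 0)) :=
    (squeeze_zero_norm hbound (tendsto_pow_atTop_nhds_zero_of_lt_one (by positivity)
      (mul_sqrt_eight_lt_one hz))).const_mul (s * t)
  have h0 : u 0 = s * t := by simp [hu, walkSum_zero]
  have := tendsto_nhds_unique hsum (hlim.const_sub (u 0))
  rw [h0] at this
  simpa [axisGF] using this.symm

theorem axisGF_chain {z : ℂ} (hz : ‖z‖ < 1 / √8) (N : ℕ) :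
    z * axisGF z 1 = ∑ n ∈ Finset.range N, (-1) ^ n * (chain z n * chain z (n + 1)) +
      (-1) ^ N * (z * chain z N ^ 2 * axisGF z (chain z N)) := by
  induction N with
  | zero => simp [chain]
  | succ N ih =>
    rw [ih, Finset.sum_range_succ, pow_succ]
    linear_combination -(-1) ^ N * axisGF_kernel hz (norm_chain_le_one hz.le N)
      (norm_chain_succ_le hz.le N) (chain_kernel hz.le N)

/-! ### Identification of `x_{0,0}` with the generating function. -/

theorem xTerm_zero_zero (k : ℕ) (z : ℂ) : xTerm 0 0 k z =
    (1 - chain z (2 * k + 2)) * (chain z (2 * k + 3) - chain z (2 * k + 1)) := by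
  rw [xTerm, α_eq_chain, α_eq_chain, β_eq_chain, show 2 * (k + 1) + 1 = 2 * k + 3 by ring]
  ring

/-- Expanding `(1 - β_k)(α_{k+1} - α_k)` gives a telescoping difference and two consecutive terms of
the alternating sum; the term `n = 0` there is `α₀`, which cancels the start of the telescope. -/
theorem sum_xTerm (z : ℂ) (K : ℕ) :
    ∑ k ∈ Finset.range K, xTerm 0 0 k z = chain z (2 * K + 1) -
      ∑ n ∈ Finset.range (2 * K + 1), (-1) ^ n * (chain z n * chain z (n + 1)) := by
  induction K with
  | zero => simp [chain]
  | succ K ih =>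
    rw [Finset.sum_range_succ, ih, show 2 * (K + 1) + 1 = 2 * K + 1 + 1 + 1 by ring,
      Finset.sum_range_succ _ (2 * K + 1 + 1), Finset.sum_range_succ _ (2 * K + 1),
      xTerm_zero_zero]
    have h1 : (-1 : ℂ) ^ (2 * K + 1) = -1 := Odd.neg_one_pow ⟨K, rfl⟩
    rw [pow_succ _ (2 * K + 1), h1]
    ring

theorem norm_xTerm_le {z : ℂ} (hz : ‖z‖ ≤ 1 / √8) (k : ℕ) :
    ‖xTerm 0 0 k z‖ ≤ 4 * (1 / 2) ^ k := by
  have hb : (2 * (1 / √8) : ℝ) ^ 2 = 1 / 2 := by rw [mul_pow, radius_sq]; norm_num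
  have hb1 : (2 * (1 / √8) : ℝ) ≤ 1 := by linarith [radius_lt]
  have hb0 : (0 : ℝ) ≤ 2 * (1 / √8) := by positivity
  have hle (m : ℕ) : ‖chain z (2 * k + m)‖ ≤ (1 / 2) ^ k := by
    rw [← hb, ← pow_mul]
    exact (chain_bounds hz _).2.trans (pow_le_pow_of_le_one hb0 hb1 (by omega))
  rw [xTerm_zero_zero, norm_mul]
  have h1 : ‖1 - chain z (2 * k + 2)‖ ≤ 2 := by
    refine (norm_sub_le _ _).trans ?_
    rw [norm_one]; linarith [norm_chain_le_one hz (2 * k + 2)]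
  have h2 : ‖chain z (2 * k + 3) - chain z (2 * k + 1)‖ ≤ 2 * (1 / 2) ^ k := by
    refine (norm_sub_le _ _).trans ?_
    linarith [hle 3, hle 1]
  calc _ ≤ (2 : ℝ) * (2 * (1 / 2) ^ k) := by gcongr
    _ = _ := by ring

theorem summable_xTerm_bound : Summable fun k : ℕ => (4 : ℝ) * (1 / 2) ^ k :=
  (summable_geometric_of_lt_one (by norm_num) (by norm_num)).mul_left 4

theorem summable_xTerm {z : ℂ} (hz : ‖z‖ ≤ 1 / √8) : Summable fun k => xTerm 0 0 k z :=
  Summable.of_norm_bounded summable_xTerm_bound (norm_xTerm_le hz)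

theorem continuousOn_h : ContinuousOn h (Metric.closedBall 0 (1 / √8)) := by
  have hx : ContinuousOn (fun z => x 0 0 z) (Metric.closedBall 0 (1 / √8)) := by
    refine continuousOn_tsum (fun k => ?_) summable_xTerm_bound
      fun k z hz => norm_xTerm_le (by simpa using hz) k
    exact ((continuousOn_const.sub (continuousOn_chain _)).mul
      ((continuousOn_chain _).sub (continuousOn_chain _))).congr fun z _ => xTerm_zero_zero k z
  have hlin : ContinuousOn (fun z : ℂ => 1 - 2 * z) (Metric.closedBall 0 (1 / √8)) := by fun_prop
  exact hlin.add (continuousOn_id.mul (hx.add hx))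

theorem tendsto_chain {z : ℂ} (hz : ‖z‖ ≤ 1 / √8) : Tendsto (chain z) atTop (𝓝 0) :=
  squeeze_zero_norm (fun n => (chain_bounds hz n).2)
    (tendsto_pow_atTop_nhds_zero_of_lt_one (by positivity) (by linarith [radius_lt]))

theorem x_eq_axisGF {z : ℂ} (hz : ‖z‖ < 1 / √8) : x 0 0 z = -(z * axisGF z 1) := by
  have hodd : Tendsto (fun K : ℕ => 2 * K + 1) atTop atTop :=
    tendsto_atTop_mono (fun K => by simp only [id]; omega) tendsto_id
  -- The bound on `axisGF` is uniform in its second argument, so the decay of the orbit kills the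
  -- remainder. It blows up on the circle, hence the open disc.
  have hrem : Tendsto (fun N => (-1) ^ N * (z * chain z N ^ 2 * axisGF z (chain z N)))
      atTop (𝓝 0) := by
    refine squeeze_zero_norm (a := fun N => ‖z‖ * ‖chain z N‖ ^ 2 * (1 - √8 * ‖z‖)⁻¹)
      (fun N => ?_) ?_
    · simp only [norm_mul, norm_pow, norm_neg, norm_one, one_pow, one_mul]
      gcongr
      exact norm_axisGF_le hz (norm_chain_le_one hz.le N)
    · simpa using (((tendsto_chain hz.le).norm.pow 2).const_mul ‖z‖).mul_const
        (1 - √8 * ‖z‖)⁻¹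
  have hlim := ((tendsto_chain hz.le).comp hodd).sub
    ((tendsto_const_nhds (x := z * axisGF z 1)).sub (hrem.comp hodd))
  refine tendsto_nhds_unique (summable_xTerm hz.le).hasSum.tendsto_sum_nat ?_
  simp only [sub_zero, zero_sub] at hlim
  refine hlim.congr fun K => ?_
  rw [sum_xTerm, axisGF_chain hz (2 * K + 1)]
  simp

theorem h_eq_axisGF {z : ℂ} (hz : ‖z‖ < 1 / √8) :
    h z = 1 - 2 * z - 2 * z ^ 2 * axisGF z 1 := by
  rw [h, xHat, x_eq_axisGF hz]; ring

/-! ### The power series of `h` on the closed disc. -/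

/-- The number of `n`-step quarter plane walks ending on the horizontal axis. -/
def axisCount (n : ℕ) : ℝ := (axisSum n 1).re

theorem axisSum_one (n : ℕ) : axisSum n 1 = axisCount n := by
  obtain ⟨r, -, hr⟩ := axisSum_ofReal_nonneg n zero_le_one
  rw [Complex.ofReal_one] at hr
  rw [axisCount, hr, Complex.ofReal_re]

theorem axisCount_nonneg (n : ℕ) : 0 ≤ axisCount n := by
  obtain ⟨r, h0, hr⟩ := axisSum_ofReal_nonneg n zero_le_one
  rw [Complex.ofReal_one] at hr
  rwa [axisCount, hr, Complex.ofReal_re]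

theorem axisGF_one_ofReal (u : ℝ) : axisGF u 1 = ((∑' n, axisCount n * u ^ n : ℝ) : ℂ) := by
  rw [Complex.ofReal_tsum, axisGF]
  exact tsum_congr fun n => by rw [axisSum_one]; push_cast; rfl

theorem norm_ofReal_lt {u : ℝ} (hu : 0 ≤ u) (hu' : u < 1 / √8) : ‖(u : ℂ)‖ < 1 / √8 := by
  simpa [abs_of_nonneg hu] using hu'

theorem summable_axisCount_of_lt {u : ℝ} (hu : 0 ≤ u) (hu' : u < 1 / √8) :
    Summable fun n => axisCount n * u ^ n := by
  have := summable_axisTerm (s := 1) (norm_ofReal_lt hu hu') (by simp)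
  simp only [axisSum_one] at this
  exact_mod_cast this

/-- Truncations of the alternating series enclose the generating function. -/
theorem axisGF_enclosure {u : ℝ} (hu : 0 ≤ u) (hu' : u < 1 / √8) (N : ℕ) :
    ∃ r : ℝ, 0 ≤ r ∧ u * ∑' n, axisCount n * u ^ n =
      ∑ n ∈ Finset.range N, (-1) ^ n * (realChain u n * realChain u (n + 1)) + (-1) ^ N * r := by
  obtain ⟨r, h0, hr⟩ := axisGF_ofReal_nonneg hu (realChain_nonneg hu N)
  refine ⟨u * realChain u N ^ 2 * r, by positivity, ?_⟩
  have := axisGF_chain (norm_ofReal_lt hu hu') N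
  simp only [chain_ofReal hu hu'.le, hr, axisGF_one_ofReal] at this
  exact_mod_cast this

/-- Truncating after one term leaves a nonpositive remainder, so the value is at most `Y_1 ≤ 1`. -/
theorem mul_axisCount_tsum_le {u : ℝ} (hu : 0 ≤ u) (hu' : u < 1 / √8) :
    u * ∑' n, axisCount n * u ^ n ≤ 1 := by
  obtain ⟨r, h0, hr⟩ := axisGF_enclosure hu hu' 1
  have h1 := norm_chain_le_one (norm_ofReal_lt hu hu').le 1
  rw [chain_ofReal hu hu'.le, Complex.norm_real] at h1
  have h2 := (le_abs_self _).trans h1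
  rw [hr]
  simp [realChain] at h2 ⊢
  linarith

/-- The bound on `u A(u, 1)` is uniform in `u < 1/√8`; letting `u` tend to `1/√8` in each partial
sum bounds them all, and the terms are nonnegative. -/
theorem summable_axisCount : Summable fun n => axisCount n * (1 / √8) ^ n := by
  refine summable_of_sum_range_le (c := √8)
    (fun n => mul_nonneg (axisCount_nonneg n) (by positivity)) fun N => ?_
  have hr := radius_pos
  have hle : (1 / √8) * ∑ n ∈ Finset.range N, axisCount n * (1 / √8) ^ n ≤ 1 := by
    have hcont : ContinuousWithinAt
        (fun u : ℝ => u * ∑ n ∈ Finset.range N, axisCount n * u ^ n) (Set.Iio (1 / √8)) (1 / √8) :=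
      Continuous.continuousWithinAt (by fun_prop)
    refine le_of_tendsto hcont ?_
    filter_upwards [Ioo_mem_nhdsLT hr] with u hu
    refine le_trans ?_ (mul_axisCount_tsum_le hu.1.le hu.2)
    gcongr
    · exact hu.1.le
    · exact (summable_axisCount_of_lt hu.1.le hu.2).sum_le_tsum _ fun n _ =>
        mul_nonneg (axisCount_nonneg n) (pow_nonneg hu.1.le n)
  rwa [one_div_mul_eq_div, div_le_one (by positivity)] at hle

theorem norm_axisCount_term_le {z : ℂ} (hz : ‖z‖ ≤ 1 / √8) (n : ℕ) :
    ‖(axisCount n : ℂ) * z ^ n‖ ≤ axisCount n * (1 / √8) ^ n := by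
  rw [norm_mul, norm_pow, Complex.norm_real, Real.norm_of_nonneg (axisCount_nonneg n)]
  have := axisCount_nonneg n
  gcongr

theorem summable_axisCount_mul_pow {z : ℂ} (hz : ‖z‖ ≤ 1 / √8) :
    Summable fun n => (axisCount n : ℂ) * z ^ n :=
  Summable.of_norm_bounded summable_axisCount (norm_axisCount_term_le hz)

/-- Both sides are continuous on the closed disc and agree inside. -/
theorem h_eq_tsum {z : ℂ} (hz : ‖z‖ ≤ 1 / √8) :
    h z = 1 - 2 * z - 2 * z ^ 2 * ∑' n, (axisCount n : ℂ) * z ^ n := by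
  have hcl : closure (Metric.ball (0 : ℂ) (1 / √8)) = Metric.closedBall 0 (1 / √8) :=
    closure_ball _ radius_pos.ne'
  have hc : ContinuousOn (fun z : ℂ => ∑' n, (axisCount n : ℂ) * z ^ n)
      (Metric.closedBall 0 (1 / √8)) :=
    continuousOn_tsum (fun n => by fun_prop) summable_axisCount
      fun n z hz => norm_axisCount_term_le (by simpa using hz) n
  have hc' : ContinuousOn (fun z : ℂ => 1 - 2 * z - 2 * z ^ 2 * ∑' n, (axisCount n : ℂ) * z ^ n)
      (Metric.closedBall 0 (1 / √8)) := by fun_prop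
  refine Set.EqOn.of_subset_closure (s := Metric.ball (0 : ℂ) (1 / √8)) (fun w hw => ?_)
    continuousOn_h hc' Metric.ball_subset_closedBall hcl.ge (by simpa using hz)
  rw [h_eq_axisGF (by simpa using hw), axisGF]
  simp only [axisSum_one]

/-- The coefficients of the power series of `h`. -/
def hCoeff : ℕ → ℂ
  | 0 => 1
  | 1 => -2
  | n + 2 => -2 * axisCount n

theorem hasSum_h {z : ℂ} (hz : ‖z‖ ≤ 1 / √8) : HasSum (fun n => hCoeff n * z ^ n) (h z) := by
  rw [h_eq_tsum hz, ← hasSum_nat_add_iff' 2]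
  have := (summable_axisCount_mul_pow hz).hasSum.mul_left (-2 * z ^ 2)
  have hval : -2 * z ^ 2 * ∑' n, (axisCount n : ℂ) * z ^ n =
      1 - 2 * z - 2 * z ^ 2 * ∑' n, (axisCount n : ℂ) * z ^ n -
        ∑ i ∈ Finset.range 2, hCoeff i * z ^ i := by
    simp [Finset.sum_range_succ, hCoeff]; ring
  rw [← hval]
  have hterm : (fun n => hCoeff (n + 2) * z ^ (n + 2)) =
      fun n => -2 * z ^ 2 * ((axisCount n : ℂ) * z ^ n) := by
    ext n; simp only [hCoeff]; ring
  rwa [hterm]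

theorem analyticAt_h {z : ℂ} (hz : ‖z‖ < 1 / √8) : AnalyticAt ℂ h z := by
  have hmem : z ∈ Metric.ball (0 : ℂ) (1 / √8) := by simpa using hz
  have hd : DifferentiableOn ℂ (fun z : ℂ => ∑' n, (axisCount n : ℂ) * z ^ n)
      (Metric.ball 0 (1 / √8)) :=
    Complex.differentiableOn_tsum_of_summable_norm summable_axisCount (fun n => by fun_prop)
      Metric.isOpen_ball fun n z hz => norm_axisCount_term_le (le_of_lt (by simpa using hz)) n
  have hd' : DifferentiableOn ℂ h (Metric.ball 0 (1 / √8)) := by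
    refine DifferentiableOn.congr (f := fun z : ℂ =>
      1 - 2 * z - 2 * z ^ 2 * ∑' n, (axisCount n : ℂ) * z ^ n) (by fun_prop) fun w hw => ?_
    exact h_eq_tsum (le_of_lt (by simpa using hw))
  exact hd'.analyticAt (Metric.isOpen_ball.mem_nhds hmem)

/-! ### Zeros of `h` and the singularity of `1/h`. -/

/-- The function `h` on the real axis. -/
def hReal (u : ℝ) : ℝ := 1 - 2 * u - 2 * u ^ 2 * ∑' n, axisCount n * u ^ n

theorem h_ofReal {u : ℝ} (hu : 0 ≤ u) (hu' : u ≤ 1 / √8) : h u = hReal u := by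
  rw [h_eq_tsum (by simpa [abs_of_nonneg hu] using hu'), hReal]
  push_cast
  rfl

theorem summable_axisCount_of_le {u : ℝ} (hu : 0 ≤ u) (hu' : u ≤ 1 / √8) :
    Summable fun n => axisCount n * u ^ n := by
  refine Summable.of_nonneg_of_le (fun n => mul_nonneg (axisCount_nonneg n) (by positivity))
    (fun n => ?_) summable_axisCount
  have := axisCount_nonneg n
  gcongr

theorem axisCount_tsum_nonneg {u : ℝ} (hu : 0 ≤ u) : 0 ≤ ∑' n, axisCount n * u ^ n :=
  tsum_nonneg fun n => mul_nonneg (axisCount_nonneg n) (pow_nonneg hu n)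

theorem axisCount_tsum_mono {u v : ℝ} (hu : 0 ≤ u) (huv : u ≤ v) (hv : v ≤ 1 / √8) :
    ∑' n, axisCount n * u ^ n ≤ ∑' n, axisCount n * v ^ n :=
  (summable_axisCount_of_le hu (huv.trans hv)).tsum_le_tsum
    (fun n => by have := axisCount_nonneg n; gcongr) (summable_axisCount_of_le (hu.trans huv) hv)

theorem hReal_strictAntiOn : StrictAntiOn hReal (Set.Icc 0 (1 / √8)) := by
  intro u hu v hv huv
  have h1 : u ^ 2 * ∑' n, axisCount n * u ^ n ≤ v ^ 2 * ∑' n, axisCount n * v ^ n := by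
    have := axisCount_tsum_nonneg hu.1
    have := axisCount_tsum_mono hu.1 huv.le hv.2
    have := hu.1
    gcongr
  simp only [hReal]
  linarith

theorem continuousOn_hReal : ContinuousOn hReal (Set.Icc 0 (1 / √8)) := by
  have hc : ContinuousOn (fun u : ℝ => ∑' n, axisCount n * u ^ n) (Set.Icc 0 (1 / √8)) :=
    continuousOn_tsum (fun n => by fun_prop) summable_axisCount fun n u hu => by
      have := axisCount_nonneg n
      have := hu.1
      rw [Real.norm_of_nonneg (by positivity)]
      gcongr
      exact hu.2
  unfold hReal
  fun_prop

open scoped ComplexOrder in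
/-- A positive zero of `h` is its only zero in the closed disc through it. -/
theorem eq_of_h_eq_zero {ρ : ℝ} (h0 : 0 ≤ ρ) (hρ : ρ ≤ 1 / √8) (hzero : hReal ρ = 0) {z : ℂ}
    (hz : ‖z‖ ≤ ρ) (hhz : h z = 0) : z = ρ := by
  have hbound : ‖∑' n, (axisCount n : ℂ) * z ^ n‖ ≤ ∑' n, axisCount n * ρ ^ n := by
    refine tsum_of_norm_bounded (summable_axisCount_of_le h0 hρ).hasSum fun n => ?_
    rw [norm_mul, norm_pow, Complex.norm_real, Real.norm_of_nonneg (axisCount_nonneg n)]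
    have := axisCount_nonneg n
    gcongr
  -- The right side is the value of the same tail at `ρ`, by `hReal ρ = 0`. Taking real parts in `h
  -- z = 0` then gives `Re z ≥ ρ ≥ ‖z‖`, which forces `z = ρ`; the linear term `-2z` replaces any
  -- aperiodicity argument.
  have htail : ‖2 * z ^ 2 * ∑' n, (axisCount n : ℂ) * z ^ n‖ ≤ 1 - 2 * ρ := by
    rw [norm_mul, norm_mul, norm_pow, Complex.norm_ofNat]
    calc _ ≤ 2 * ρ ^ 2 * ∑' n, axisCount n * ρ ^ n := by gcongr
      _ = _ := by rw [hReal] at hzero; linarith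
  rw [h_eq_tsum (hz.trans hρ)] at hhz
  have hre := congrArg Complex.re hhz
  have hre' := (Complex.re_le_norm _).trans htail
  simp only [Complex.sub_re, Complex.one_re, Complex.zero_re] at hre
  have h2z : (2 * z).re = 2 * z.re := by simp
  have hge : ρ ≤ z.re := by linarith
  have hle : z.re ≤ ‖z‖ := Complex.re_le_norm z
  have hnn : 0 ≤ z := Complex.re_eq_norm.mp (le_antisymm hle (hz.trans hge))
  refine Complex.ext ?_ ?_
  · rw [Complex.ofReal_re]; linarith
  · rw [Complex.ofReal_im]; exact (Complex.nonneg_iff.mp hnn).2.symm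

theorem isDominantSingularity_c {ρ : ℝ} (h0 : 0 < ρ) (hρ : ρ < 1 / √8) (hzero : hReal ρ = 0) :
    IsDominantSingularity c (ρ : ℂ) := by
  have hn : ‖(ρ : ℂ)‖ = ρ := by simp [abs_of_pos h0]
  have hc : c = fun z => (h z)⁻¹ := funext fun z => one_div _
  have han {z : ℂ} (hz : ‖z‖ ≤ ρ) (hne : z ≠ ρ) : AnalyticAt ℂ c z := by
    rw [hc]
    exact (analyticAt_h (hz.trans_lt hρ)).inv
      fun hh => hne (eq_of_h_eq_zero h0.le hρ.le hzero hz hh)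
  refine ⟨fun z hz => ?_, ?_, fun w hw hne => ?_⟩
  · rw [hn, mem_ball_zero_iff] at hz
    refine han hz.le ?_
    rintro rfl
    exact hz.ne hn
  · rintro ⟨g, hg, hgc⟩
    rw [hn] at hgc
    -- A continuation `g` would satisfy `g h = 1` in the disc near `ρ`, whereas `g h` tends to `g ρ
    -- * 0 = 0` at `ρ`.
    have hprod : ∀ᶠ z in 𝓝[Metric.ball 0 ρ] (ρ : ℂ), g z * h z = 1 := by
      filter_upwards [hgc, self_mem_nhdsWithin] with z hz hzb
      rw [mem_ball_zero_iff] at hzb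
      rw [hz, hc, inv_mul_cancel₀]
      intro hh
      have := eq_of_h_eq_zero h0.le hρ.le hzero hzb.le hh
      rw [this, hn] at hzb
      exact hzb.false
    have hcont : Tendsto (fun z => g z * h z) (𝓝[Metric.ball 0 ρ] (ρ : ℂ)) (𝓝 (g ρ * h ρ)) :=
      ((hg.continuousAt.mul (analyticAt_h (hn.trans_lt hρ)).continuousAt).tendsto).mono_left
        nhdsWithin_le_nhds
    have hcl : (ρ : ℂ) ∈ closure (Metric.ball 0 ρ) := by
      rw [closure_ball _ h0.ne']; simp [abs_of_pos h0]
    have : (𝓝[Metric.ball 0 ρ] (ρ : ℂ)).NeBot := mem_closure_iff_nhdsWithin_neBot.mp hcl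
    have heq := tendsto_nhds_unique (hcont.congr' hprod) tendsto_const_nhds
    rw [h_ofReal h0.le hρ.le, hzero] at heq
    simp at heq
  · rw [hn, mem_sphere_zero_iff_norm] at hw
    exact ⟨c, han hw.le hne, Eventually.of_forall fun _ => rfl⟩

/-! ### Numerical location of the zero. -/

/-- Propagation of an enclosure of the orbit through one application of `f`. The ratio of
consecutive terms is the smaller root `y` of `y = u + u (1 + t²) y²`. -/
theorem realChain_succ_mem {u l m Yl Yu l' m' : ℝ} {n : ℕ} (hu : 0 ≤ u) (hu' : u ≤ 1 / √8)
    (ht : realChain u n ∈ Set.Icc l m) (hl : 0 ≤ l) (hYl : 0 ≤ Yl) (hYu : 0 ≤ Yu)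
    (hvert : 4 * u * Yl ≤ 1) (hlow : Yl ≤ u + u * (1 + l ^ 2) * Yl ^ 2)
    (hup : u + u * (1 + m ^ 2) * Yu ^ 2 ≤ Yu) (hl' : l' ≤ l * Yl) (hm' : m * Yu ≤ m') :
    realChain u (n + 1) ∈ Set.Icc l' m' := by
  have hz : ‖(u : ℂ)‖ ≤ 1 / √8 := by simpa [abs_of_nonneg hu] using hu'
  have ht1 : realChain u n ≤ 1 := by
    have := norm_chain_le_one hz n
    rw [chain_ofReal hu hu', Complex.norm_real] at this
    exact (le_abs_self _).trans this
  rw [realChain]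
  obtain ⟨hlt, htm⟩ := ht
  generalize realChain u n = t at *
  have ht0 : 0 ≤ t := hl.trans hlt
  have hu2 : u ^ 2 ≤ 1 / 8 := by rw [← radius_sq]; gcongr
  have hD : 0 ≤ 1 - 4 * u ^ 2 * (1 + t ^ 2) := by nlinarith [sq_nonneg u]
  have hd2 := Real.sq_sqrt hD
  have hd0 := Real.sqrt_nonneg (1 - 4 * u ^ 2 * (1 + t ^ 2))
  generalize √(1 - 4 * u ^ 2 * (1 + t ^ 2)) = d at *
  have hlow' : Yl ≤ u + u * (1 + t ^ 2) * Yl ^ 2 := hlow.trans (by gcongr)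
  have hup' : u + u * (1 + t ^ 2) * Yu ^ 2 ≤ Yu := le_trans (by gcongr) hup
  have hyl : Yl ≤ 2 * u / (1 + d) := by
    rw [le_div_iff₀ (by positivity)]
    -- As `t ≤ 1`, `hvert` puts `Yl` left of the vertex `1 / (2u(1 + t²))` of the quadratic, which
    -- is nonnegative at `Yl`; so `Yl` is below the smaller root.
    have hv : 2 * u * (1 + t ^ 2) * Yl ≤ 1 := by
      have : 2 * u * (1 + t ^ 2) * Yl ≤ 2 * u * (1 + 1) * Yl := by
        gcongr; nlinarith
      linarith
    have hdle : d ≤ 1 - 2 * u * (1 + t ^ 2) * Yl := by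
      refine abs_le_of_sq_le_sq' ?_ (by linarith) |>.2
      nlinarith [mul_nonneg hu (by positivity : 0 ≤ 1 + t ^ 2)]
    nlinarith
  -- The quadratic is nonpositive at `Yu`, so `Yu` lies between the roots; no vertex condition is
  -- needed.
  have hyu : 2 * u / (1 + d) ≤ Yu := by
    rw [div_le_iff₀ (by positivity)]
    by_contra! hcon
    have h1 : Yu * d < 2 * u - Yu := by linarith
    have h2 : (Yu * d) ^ 2 < (2 * u - Yu) ^ 2 := by gcongr
    have h3 : 0 < u := by
      by_contra! h4
      have : u = 0 := le_antisymm h4 hu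
      subst this
      nlinarith [mul_nonneg hYu hd0]
    nlinarith
  have hYl0 : 0 ≤ 2 * u / (1 + d) := by positivity
  constructor
  · calc l' ≤ l * Yl := hl'
      _ ≤ t * (2 * u / (1 + d)) := by gcongr
      _ = _ := mul_comm _ _
  · calc 2 * u / (1 + d) * t = t * (2 * u / (1 + d)) := mul_comm _ _
      _ ≤ m * Yu := by gcongr; exact ht0.trans htm
      _ ≤ m' := hm'

theorem lt_radius {u : ℝ} (h0 : u ^ 2 < 1 / 8) : u < 1 / √8 := by
  rw [← radius_sq] at h0
  exact lt_of_pow_lt_pow_left₀ 2 radius_pos.le h0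

theorem hReal_left_nonneg : 0 ≤ hReal 0.34499975 := by
  have hu : (0 : ℝ) ≤ 0.34499975 := by norm_num
  have hr : (0.34499975 : ℝ) < 1 / √8 := lt_radius (by norm_num)
  have t0 : realChain 0.34499975 0 ∈ Set.Icc (1 : ℝ) 1 := by simp [realChain]
  have t1 : realChain 0.34499975 1 ∈ Set.Icc (0.56620673851692 : ℝ) 0.56620673851695 :=
    realChain_succ_mem hu hr.le t0 (Yl := 0.56620673851692) (Yu := 0.56620673851695) (by norm_num) (by norm_num)
      (by norm_num) (by norm_num) (by norm_num) (by norm_num) (by norm_num) (by norm_num)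
  have t2 : realChain 0.34499975 2 ∈ Set.Icc (0.24276274511274 : ℝ) 0.24276274511278 :=
    realChain_succ_mem hu hr.le t1 (Yl := 0.42875283637320) (Yu := 0.42875283637323) (by norm_num) (by norm_num)
      (by norm_num) (by norm_num) (by norm_num) (by norm_num) (by norm_num) (by norm_num)
  have t3 : realChain 0.34499975 3 ∈ Set.Icc (0.09829247154703 : ℝ) 0.09829247154706 :=
    realChain_succ_mem hu hr.le t2 (Yl := 0.40489108615652) (Yu := 0.40489108615655) (by norm_num) (by norm_num)
      (by norm_num) (by norm_num) (by norm_num) (by norm_num) (by norm_num) (by norm_num)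
  have t4 : realChain 0.34499975 4 ∈ Set.Icc (0.03941692251776 : ℝ) 0.03941692251779 :=
    realChain_succ_mem hu hr.le t3 (Yl := 0.40101669942147) (Yu := 0.40101669942150) (by norm_num) (by norm_num)
      (by norm_num) (by norm_num) (by norm_num) (by norm_num) (by norm_num) (by norm_num)
  have t5 : realChain 0.34499975 5 ∈ Set.Icc (0.01578232327191 : ℝ) 0.01578232327193 :=
    realChain_succ_mem hu hr.le t4 (Yl := 0.40039460880791) (Yu := 0.40039460880794) (by norm_num) (by norm_num)
      (by norm_num) (by norm_num) (by norm_num) (by norm_num) (by norm_num) (by norm_num)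
  have t6 : realChain 0.34499975 6 ∈ Set.Icc (0.00631758355790 : ℝ) 0.00631758355792 :=
    realChain_succ_mem hu hr.le t5 (Yl := 0.40029490266190) (Yu := 0.40029490266193) (by norm_num) (by norm_num)
      (by norm_num) (by norm_num) (by norm_num) (by norm_num) (by norm_num) (by norm_num)
  have t7 : realChain 0.34499975 7 ∈ Set.Icc (0.00252879556642 : ℝ) 0.00252879556644 :=
    realChain_succ_mem hu hr.le t6 (Yl := 0.40027892678461) (Yu := 0.40027892678464) (by norm_num) (by norm_num)
      (by norm_num) (by norm_num) (by norm_num) (by norm_num) (by norm_num) (by norm_num)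
  have t8 : realChain 0.34499975 8 ∈ Set.Icc (0.00101221710245 : ℝ) 0.00101221710246 :=
    realChain_succ_mem hu hr.le t7 (Yl := 0.40027636709449) (Yu := 0.40027636709452) (by norm_num) (by norm_num)
      (by norm_num) (by norm_num) (by norm_num) (by norm_num) (by norm_num) (by norm_num)
  have t9 : realChain 0.34499975 9 ∈ Set.Icc (0.00040516616935 : ℝ) 0.00040516616936 :=
    realChain_succ_mem hu hr.le t8 (Yl := 0.40027595697836) (Yu := 0.40027595697839) (by norm_num) (by norm_num)
      (by norm_num) (by norm_num) (by norm_num) (by norm_num) (by norm_num) (by norm_num)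
  have t10 : realChain 0.34499975 10 ∈ Set.Icc (0.00016217824954 : ℝ) 0.00016217824956 :=
    realChain_succ_mem hu hr.le t9 (Yl := 0.40027589126922) (Yu := 0.40027589126925) (by norm_num) (by norm_num)
      (by norm_num) (by norm_num) (by norm_num) (by norm_num) (by norm_num) (by norm_num)
  have t11 : realChain 0.34499975 11 ∈ Set.Icc (0.00006491604167 : ℝ) 0.00006491604168 :=
    realChain_succ_mem hu hr.le t10 (Yl := 0.40027588074125) (Yu := 0.40027588074128) (by norm_num) (by norm_num)
      (by norm_num) (by norm_num) (by norm_num) (by norm_num) (by norm_num) (by norm_num)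
  -- Odd truncation overestimates `u A(u, 1)`, hence underestimates `h`. Positive terms are bounded
  -- above and negative ones below accordingly.
  obtain ⟨r, hr0, hsum⟩ := axisGF_enclosure hu hr 11
  have p0 : realChain 0.34499975 0 * realChain 0.34499975 1 ≤ 1 * 0.56620673851695 :=
    mul_le_mul t0.2 t1.2 (realChain_nonneg hu _) (by norm_num)
  have p1 : 0.56620673851692 * 0.24276274511274 ≤ realChain 0.34499975 1 * realChain 0.34499975 2 :=
    mul_le_mul t1.1 t2.1 (by norm_num) (realChain_nonneg hu _)
  have p2 : realChain 0.34499975 2 * realChain 0.34499975 3 ≤ 0.24276274511278 * 0.09829247154706 :=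
    mul_le_mul t2.2 t3.2 (realChain_nonneg hu _) (by norm_num)
  have p3 : 0.09829247154703 * 0.03941692251776 ≤ realChain 0.34499975 3 * realChain 0.34499975 4 :=
    mul_le_mul t3.1 t4.1 (by norm_num) (realChain_nonneg hu _)
  have p4 : realChain 0.34499975 4 * realChain 0.34499975 5 ≤ 0.03941692251779 * 0.01578232327193 :=
    mul_le_mul t4.2 t5.2 (realChain_nonneg hu _) (by norm_num)
  have p5 : 0.01578232327191 * 0.00631758355790 ≤ realChain 0.34499975 5 * realChain 0.34499975 6 :=
    mul_le_mul t5.1 t6.1 (by norm_num) (realChain_nonneg hu _)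
  have p6 : realChain 0.34499975 6 * realChain 0.34499975 7 ≤ 0.00631758355792 * 0.00252879556644 :=
    mul_le_mul t6.2 t7.2 (realChain_nonneg hu _) (by norm_num)
  have p7 : 0.00252879556642 * 0.00101221710245 ≤ realChain 0.34499975 7 * realChain 0.34499975 8 :=
    mul_le_mul t7.1 t8.1 (by norm_num) (realChain_nonneg hu _)
  have p8 : realChain 0.34499975 8 * realChain 0.34499975 9 ≤ 0.00101221710246 * 0.00040516616936 :=
    mul_le_mul t8.2 t9.2 (realChain_nonneg hu _) (by norm_num)
  have p9 : 0.00040516616935 * 0.00016217824954 ≤ realChain 0.34499975 9 * realChain 0.34499975 10 :=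
    mul_le_mul t9.1 t10.1 (by norm_num) (realChain_nonneg hu _)
  have p10 : realChain 0.34499975 10 * realChain 0.34499975 11 ≤ 0.00016217824956 * 0.00006491604168 :=
    mul_le_mul t10.2 t11.2 (realChain_nonneg hu _) (by norm_num)
  simp only [Finset.sum_range_succ, Finset.sum_range_zero] at hsum
  norm_num only at hsum p0 p1 p2 p3 p4 p5 p6 p7 p8 p9 p10 ⊢
  rw [hReal]
  linarith

theorem hReal_right_nonpos : hReal 0.34499976 ≤ 0 := by
  have hu : (0 : ℝ) ≤ 0.34499976 := by norm_num
  have hr : (0.34499976 : ℝ) < 1 / √8 := lt_radius (by norm_num)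
  have t0 : realChain 0.34499976 0 ∈ Set.Icc (1 : ℝ) 1 := by simp [realChain]
  have t1 : realChain 0.34499976 1 ∈ Set.Icc (0.56620681358169 : ℝ) 0.56620681358172 :=
    realChain_succ_mem hu hr.le t0 (Yl := 0.56620681358169) (Yu := 0.56620681358172) (by norm_num) (by norm_num)
      (by norm_num) (by norm_num) (by norm_num) (by norm_num) (by norm_num) (by norm_num)
  have t2 : realChain 0.34499976 2 ∈ Set.Icc (0.24276279385495 : ℝ) 0.24276279385499 :=
    realChain_succ_mem hu hr.le t1 (Yl := 0.42875286561688) (Yu := 0.42875286561691) (by norm_num) (by norm_num)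
      (by norm_num) (by norm_num) (by norm_num) (by norm_num) (by norm_num) (by norm_num)
  have t3 : realChain 0.34499976 3 ∈ Set.Icc (0.09829249578980 : ℝ) 0.09829249578984 :=
    realChain_succ_mem hu hr.le t2 (Yl := 0.40489110472396) (Yu := 0.40489110472400) (by norm_num) (by norm_num)
      (by norm_num) (by norm_num) (by norm_num) (by norm_num) (by norm_num) (by norm_num)
  have t4 : realChain 0.34499976 4 ∈ Set.Icc (0.03941693386104 : ℝ) 0.03941693386107 :=
    realChain_succ_mem hu hr.le t3 (Yl := 0.40101671591838) (Yu := 0.40101671591841) (by norm_num) (by norm_num)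
      (by norm_num) (by norm_num) (by norm_num) (by norm_num) (by norm_num) (by norm_num)
  have t5 : realChain 0.34499976 5 ∈ Set.Icc (0.01578232844885 : ℝ) 0.01578232844887 :=
    realChain_succ_mem hu hr.le t4 (Yl := 0.40039462492174) (Yu := 0.40039462492177) (by norm_num) (by norm_num)
      (by norm_num) (by norm_num) (by norm_num) (by norm_num) (by norm_num) (by norm_num)
  have t6 : realChain 0.34499976 6 ∈ Set.Icc (0.00631758588342 : ℝ) 0.00631758588344 :=
    realChain_succ_mem hu hr.le t5 (Yl := 0.40029491870632) (Yu := 0.40029491870635) (by norm_num) (by norm_num)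
      (by norm_num) (by norm_num) (by norm_num) (by norm_num) (by norm_num) (by norm_num)
  have t7 : realChain 0.34499976 7 ∈ Set.Icc (0.00252879659856 : ℝ) 0.00252879659858 :=
    realChain_succ_mem hu hr.le t6 (Yl := 0.40027894281663) (Yu := 0.40027894281666) (by norm_num) (by norm_num)
      (by norm_num) (by norm_num) (by norm_num) (by norm_num) (by norm_num) (by norm_num)
  have t8 : realChain 0.34499976 8 ∈ Set.Icc (0.00101221755612 : ℝ) 0.00101221755614 :=
    realChain_succ_mem hu hr.le t7 (Yl := 0.40027638312431) (Yu := 0.40027638312434) (by norm_num) (by norm_num)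
      (by norm_num) (by norm_num) (by norm_num) (by norm_num) (by norm_num) (by norm_num)
  have t9 : realChain 0.34499976 9 ∈ Set.Icc (0.00040516636717 : ℝ) 0.00040516636718 :=
    realChain_succ_mem hu hr.le t8 (Yl := 0.40027597300780) (Yu := 0.40027597300783) (by norm_num) (by norm_num)
      (by norm_num) (by norm_num) (by norm_num) (by norm_num) (by norm_num) (by norm_num)
  have t10 : realChain 0.34499976 10 ∈ Set.Icc (0.00016217833522 : ℝ) 0.00016217833523 :=
    realChain_succ_mem hu hr.le t9 (Yl := 0.40027590729860) (Yu := 0.40027590729863) (by norm_num) (by norm_num)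
      (by norm_num) (by norm_num) (by norm_num) (by norm_num) (by norm_num) (by norm_num)
  have t11 : realChain 0.34499976 11 ∈ Set.Icc (0.00006491607856 : ℝ) 0.00006491607858 :=
    realChain_succ_mem hu hr.le t10 (Yl := 0.40027589677062) (Yu := 0.40027589677065) (by norm_num) (by norm_num)
      (by norm_num) (by norm_num) (by norm_num) (by norm_num) (by norm_num) (by norm_num)
  have t12 : realChain 0.34499976 12 ∈ Set.Icc (0.00002598434145 : ℝ) 0.00002598434146 :=
    realChain_succ_mem hu hr.le t11 (Yl := 0.40027589508381) (Yu := 0.40027589508384) (by norm_num) (by norm_num)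
      (by norm_num) (by norm_num) (by norm_num) (by norm_num) (by norm_num) (by norm_num)
  -- Even truncation, with the roles of the bounds exchanged, gives an upper estimate of `h`.
  obtain ⟨r, hr0, hsum⟩ := axisGF_enclosure hu hr 12
  have p0 : 1 * 0.56620681358169 ≤ realChain 0.34499976 0 * realChain 0.34499976 1 :=
    mul_le_mul t0.1 t1.1 (by norm_num) (realChain_nonneg hu _)
  have p1 : realChain 0.34499976 1 * realChain 0.34499976 2 ≤ 0.56620681358172 * 0.24276279385499 :=
    mul_le_mul t1.2 t2.2 (realChain_nonneg hu _) (by norm_num)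
  have p2 : 0.24276279385495 * 0.09829249578980 ≤ realChain 0.34499976 2 * realChain 0.34499976 3 :=
    mul_le_mul t2.1 t3.1 (by norm_num) (realChain_nonneg hu _)
  have p3 : realChain 0.34499976 3 * realChain 0.34499976 4 ≤ 0.09829249578984 * 0.03941693386107 :=
    mul_le_mul t3.2 t4.2 (realChain_nonneg hu _) (by norm_num)
  have p4 : 0.03941693386104 * 0.01578232844885 ≤ realChain 0.34499976 4 * realChain 0.34499976 5 :=
    mul_le_mul t4.1 t5.1 (by norm_num) (realChain_nonneg hu _)
  have p5 : realChain 0.34499976 5 * realChain 0.34499976 6 ≤ 0.01578232844887 * 0.00631758588344 :=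
    mul_le_mul t5.2 t6.2 (realChain_nonneg hu _) (by norm_num)
  have p6 : 0.00631758588342 * 0.00252879659856 ≤ realChain 0.34499976 6 * realChain 0.34499976 7 :=
    mul_le_mul t6.1 t7.1 (by norm_num) (realChain_nonneg hu _)
  have p7 : realChain 0.34499976 7 * realChain 0.34499976 8 ≤ 0.00252879659858 * 0.00101221755614 :=
    mul_le_mul t7.2 t8.2 (realChain_nonneg hu _) (by norm_num)
  have p8 : 0.00101221755612 * 0.00040516636717 ≤ realChain 0.34499976 8 * realChain 0.34499976 9 :=
    mul_le_mul t8.1 t9.1 (by norm_num) (realChain_nonneg hu _)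
  have p9 : realChain 0.34499976 9 * realChain 0.34499976 10 ≤ 0.00040516636718 * 0.00016217833523 :=
    mul_le_mul t9.2 t10.2 (realChain_nonneg hu _) (by norm_num)
  have p10 : 0.00016217833522 * 0.00006491607856 ≤ realChain 0.34499976 10 * realChain 0.34499976 11 :=
    mul_le_mul t10.1 t11.1 (by norm_num) (realChain_nonneg hu _)
  have p11 : realChain 0.34499976 11 * realChain 0.34499976 12 ≤ 0.00006491607858 * 0.00002598434146 :=
    mul_le_mul t11.2 t12.2 (realChain_nonneg hu _) (by norm_num)
  simp only [Finset.sum_range_succ, Finset.sum_range_zero] at hsum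
  norm_num only at hsum p0 p1 p2 p3 p4 p5 p6 p7 p8 p9 p10 p11 ⊢
  rw [hReal]
  linarith

theorem exists_zero_hReal :
    ∃ ρ ∈ Set.Icc (0.34499975 : ℝ) 0.34499976, hReal ρ = 0 := by
  have hr : (0.34499976 : ℝ) < 1 / √8 := lt_radius (by norm_num)
  have hcont : ContinuousOn hReal (Set.Icc (0.34499975 : ℝ) 0.34499976) :=
    continuousOn_hReal.mono (Set.Icc_subset_Icc (by norm_num) hr.le)
  exact intermediate_value_Icc' (by norm_num) hcont ⟨hReal_right_nonpos, hReal_left_nonneg⟩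

end
end QuarterWalk

theorem lemma7 :
    -- convergence for `|z| ≤ 1/√8`: of the series defining `x̂_{0,0}`, and of `h` as a power series
    (∀ z : ℂ, ‖z‖ ≤ 1 / √8 → Summable (fun k : ℕ => QuarterWalk.xTerm 0 0 k z)) ∧
    (∃ a : ℕ → ℂ, ∀ z : ℂ, ‖z‖ ≤ 1 / √8 →
      HasSum (fun n : ℕ => a n * z ^ n) (QuarterWalk.h z)) ∧
    -- the unique zero in `(1/3, 1/√8)`, which is the first positive zero and the dominant
    -- singularity of `c`, and its numerical location
    ∃ ρ : ℝ,
      (ρ ∈ Set.Ioo (1 / 3 : ℝ) (1 / √8) ∧ QuarterWalk.h (ρ : ℂ) = 0 ∧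
        ∀ t ∈ Set.Ioo (1 / 3 : ℝ) (1 / √8), QuarterWalk.h (t : ℂ) = 0 → t = ρ) ∧
      (∀ t ∈ Set.Ioo (0 : ℝ) ρ, QuarterWalk.h (t : ℂ) ≠ 0) ∧
      QuarterWalk.IsDominantSingularity QuarterWalk.c (ρ : ℂ) ∧
      ρ ∈ Set.Icc (0.34499975 : ℝ) 0.34499976 := by
  refine ⟨fun z hz => QuarterWalk.summable_xTerm hz,
    ⟨QuarterWalk.hCoeff, fun z hz => QuarterWalk.hasSum_h hz⟩, ?_⟩
  obtain ⟨ρ, hmem, hzero⟩ := QuarterWalk.exists_zero_hReal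
  have h13 : (1 / 3 : ℝ) < ρ := lt_of_lt_of_le (by norm_num) hmem.1
  have h0 : 0 < ρ := lt_trans (by norm_num) h13
  have hr : ρ < 1 / √8 :=
    hmem.2.trans_lt (QuarterWalk.lt_radius (by norm_num))
  have huniq (t : ℝ) (ht : 0 < t) (ht' : t < 1 / √8) (hh : QuarterWalk.h (t : ℂ) = 0) : t = ρ := by
    rw [QuarterWalk.h_ofReal ht.le ht'.le, Complex.ofReal_eq_zero] at hh
    exact QuarterWalk.hReal_strictAntiOn.injOn ⟨ht.le, ht'.le⟩ ⟨h0.le, hr.le⟩ (hh.trans hzero.symm)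
  refine ⟨ρ, ⟨⟨h13, hr⟩, ?_, fun t ht => huniq t (lt_trans (by norm_num) ht.1) ht.2⟩,
    fun t ht hh => ht.2.ne (huniq t ht.1 (ht.2.trans hr) hh),
    QuarterWalk.isDominantSingularity_c h0 hr hzero, hmem⟩
  rw [QuarterWalk.h_ofReal h0.le hr.le, hzero, Complex.ofReal_zero]
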